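/- For a finite subgroup $G\le \mathrm{GL}(\mathbb{C}^n)$ let $\mathcal{A}_G=\{\ker(1-r)\}$, where $r$ runs over the complex reflections in $G$, i.e. the maps $r(v)=v-(1-\xi)\frac{\langle v,u\rangle}{\langle u,u\rangle}u$ in $G$ with $u\in\mathbb{C}^n\setminus\{0\}$ and $\xi\neq 1$ a root of unity. For a finite hyperplane arrangement $\mathcal{B}$ in $\mathbb{C}^n$ let $\mathrm{rk}\,\mathcal{B}=n-\dim\bigcap_{H\in\mathcal{B}}H$, and let $$T_G(x,y)=\sum_{\mathcal{B}\subseteq\mathcal{A}_G}(x-1)^{\mathrm{rk}\,\mathcal{A}_G-\mathrm{rk}\,\mathcal{B}}\,(y-1)^{\#\mathcal{B}-\mathrm{rk}\,\mathcal{B}}$$ be the Tutte polynomial of $\mathcal{A}_G$. For positive integers $p\mid m$ and $n\ge 0$, let $G(m,p,n)$ be the group of $n\times n$ monomial complex matrices whose nonzero entries are $m$-th roots of unity with product an $(m/p)$-th root of unity. **Theorem.** Let $m,p$ be positive integers with $p\mid m$ and $m\neq p$ (so $m\ge 2$). Then, as formal power series in $t$, $$\sum_{n\ge 0}\frac{T_{G(m,p,n)}(x,y)}{n!}t^n=\bigg(\sum_{n\ge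 0}\frac{y^{m\binom n2+n}}{(y-1)^n\,n!}t^n\bigg)\bigg(\sum_{n\ge 0}\frac{m^n y^{\binom n2}}{(y-1)^n\,n!}t^n\bigg)^{\frac{(x-1)(y-1)-1}{m}}.$$ Moreover, if the value of $T_{G(m,m,1)}(x,y)$ is replaced by $x-1$ by convention, while all the other $T_{G(m,m,n)}(x,y)$ are unchanged, then $$\sum_{n\ge 0}\frac{T_{G(m,m,n)}(x,y)}{n!}t^n=\bigg(\sum_{n\ge 0}\frac{y^{m\binom n2}}{(y-1)^n\,n!}t^n\bigg)\bigg(\sum_{n\ge 0}\frac{m^n y^{\binom n2}}{(y-1)^n\,n!}t^n\bigg)^{\frac{(x-1)(y-1)-1}{m}}.$$ Here $x,y$ are indeterminates, or any elements with $y\neq 1$ of a field of characteristic $0$, and for a power series $F$ with constant term $1$ one sets $F^c=\exp(c\log F)$. -/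

import Mathlib

noncomputable section

namespace ReflTutte

/-- The Hermitian space `ℂⁿ`. -/
abbrev Space (n : ℕ) : Type := EuclideanSpace ℂ (Fin n)

/-- `GL(ℂⁿ)`, the group of invertible linear endomorphisms of `ℂⁿ`. -/
abbrev GLSpace (n : ℕ) : Type := LinearMap.GeneralLinearGroup ℂ (Space n)

/-- `f` is a complex reflection: `f = r_{u,ξ}` for some `u ≠ 0` and some root of unity `ξ ≠ 1`, where
`r_{u,ξ}(x) = x - (1 - ξ) (⟨x,u⟩ / ⟨u,u⟩) u`. Mathlib's `inner ℂ u x` is linear in `x` and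
conjugate-linear in `u`, so it is `⟨x,u⟩` in the convention of this formula. -/
def IsComplexReflection {n : ℕ} (f : Space n →ₗ[ℂ] Space n) : Prop :=
  ∃ (u : Space n) (ξ : ℂ), u ≠ 0 ∧ ξ ≠ 1 ∧ (∃ k : ℕ, 0 < k ∧ ξ ^ k = 1) ∧
    ∀ x : Space n, f x = x - ((1 - ξ) * (inner ℂ u x / inner ℂ u u)) • u

/-- The set of hyperplanes `ker(1 - r)`, for `r` a complex reflection in `G`. -/
def arrangementSet {n : ℕ} (G : Subgroup (GLSpace n)) : Set (Submodule ℂ (Space n)) :=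
  {H | ∃ r ∈ G, IsComplexReflection (r : Space n →ₗ[ℂ] Space n) ∧
    H = LinearMap.ker (1 - (r : Space n →ₗ[ℂ] Space n))}

theorem arrangementSet_finite {n : ℕ} (G : Subgroup (GLSpace n)) [Finite G] :
    (arrangementSet G).Finite := by
  refine (Set.finite_range
    (fun r : G => LinearMap.ker (1 - ((r : GLSpace n) : Space n →ₗ[ℂ] Space n)))).subset ?_
  rintro H ⟨r, hr, -, rfl⟩
  exact ⟨⟨r, hr⟩, rfl⟩

/-- The hyperplane arrangement `𝒜_G` of a finite group `G ≤ GL(ℂⁿ)`. -/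
def arrangement {n : ℕ} (G : Subgroup (GLSpace n)) [Finite G] :
    Finset (Submodule ℂ (Space n)) :=
  (arrangementSet_finite G).toFinset

/-- The rank `n - dim ⋂_{H ∈ 𝒜} H` of an arrangement in `ℂⁿ`; the empty intersection is `ℂⁿ`. -/
def rk {n : ℕ} (A : Finset (Submodule ℂ (Space n))) : ℕ :=
  n - Module.finrank ℂ (A.inf id : Submodule ℂ (Space n))

open MvPolynomial in
/-- The Tutte polynomial of an arrangement `A` of hyperplanes, in the variables `x = X 0` and
`y = X 1`. Since `rk B ≤ rk A` and `rk B ≤ #B`, no subtraction in an exponent truncates. -/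
def tuttePolynomial {n : ℕ} (A : Finset (Submodule ℂ (Space n))) : MvPolynomial (Fin 2) ℤ :=
  ∑ B ∈ A.powerset, (X 0 - 1) ^ (rk A - rk B) * (X 1 - 1) ^ (B.card - rk B)

/-- The value at `(x, y)` of the Tutte polynomial `T_G` of the arrangement of `G`. -/
def tutte {n : ℕ} (G : Subgroup (GLSpace n)) [Finite G] {R : Type*} [CommRing R] (x y : R) : R :=
  MvPolynomial.aeval ![x, y] (tuttePolynomial (arrangement G))

/-- The group `G(m,p,n)` (for `p ∣ m`): the linear maps of `ℂⁿ` given by monomial matrices whose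
nonzero entries `θ 0, …, θ (n-1)` are `m`-th roots of unity with `(∏ i, θ i) ^ (m / p) = 1`. -/
def imprimitiveGroup (m p n : ℕ) : Subgroup (GLSpace n) where
  carrier := {g | ∃ (σ : Equiv.Perm (Fin n)) (θ : Fin n → ℂˣ), (∀ i, θ i ^ m = 1) ∧
    (∏ i, θ i) ^ (m / p) = 1 ∧
    ∀ (x : Space n) (i : Fin n), (g : Space n →ₗ[ℂ] Space n) x i = (θ i : ℂ) * x (σ i)}
  one_mem' := ⟨1, fun _ => 1, by simp, by simp, by simp⟩
  mul_mem' := by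
    rintro g h ⟨σ, θ, h1, h2, h3⟩ ⟨τ, η, k1, k2, k3⟩
    refine ⟨σ.trans τ, fun i => θ i * η (σ i), fun i => ?_, ?_, fun x i => ?_⟩
    · rw [mul_pow, h1, k1, one_mul]
    · rw [Finset.prod_mul_distrib, Equiv.prod_comp σ η, mul_pow, h2, k2, one_mul]
    · simp [h3, k3, mul_assoc]
  inv_mem' := by
    rintro g ⟨σ, θ, h1, h2, h3⟩
    refine ⟨σ.symm, fun i => (θ (σ.symm i))⁻¹, fun i => ?_, ?_, fun x i => ?_⟩
    · rw [inv_pow, h1, inv_one]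
    · rw [Finset.prod_inv_distrib, Equiv.prod_comp σ.symm θ, inv_pow, h2, inv_one]
    · have hx : (g : Space n →ₗ[ℂ] Space n) (((g⁻¹ : GLSpace n) : Space n →ₗ[ℂ] Space n) x) = x := by
        rw [← Module.End.mul_apply, ← Units.val_mul, mul_inv_cancel, Units.val_one,
          Module.End.one_apply]
      have := h3 (((g⁻¹ : GLSpace n) : Space n →ₗ[ℂ] Space n) x) (σ.symm i)
      rw [hx, Equiv.apply_symm_apply] at this
      rw [this, ← mul_assoc, Units.inv_mul, one_mul]

instance imprimitiveGroup_finite (m p n : ℕ) [NeZero m] : Finite (imprimitiveGroup m p n) := by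
  choose σ θ h1 _ h3 using fun g : imprimitiveGroup m p n => g.2
  refine Finite.of_injective (β := Equiv.Perm (Fin n) × (Fin n → rootsOfUnity m ℂ))
    (fun g => (σ g, fun i => ⟨θ g i, h1 g i⟩)) fun g g' hgg => ?_
  rw [Prod.mk.injEq] at hgg
  have hθ : ∀ i, θ g i = θ g' i := fun i => congrArg Subtype.val (congrFun hgg.2 i)
  refine Subtype.ext (Units.ext (LinearMap.ext fun x => ?_))
  ext i
  rw [h3, h3, hgg.1, hθ]

/-- The power `f ^ c := exp (c • log f)` of a formal power series `f` with constant coefficient `1`,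
for an exponent `c` in the coefficient field. -/
def seriesPow {K : Type*} [Field K] [CharZero K] (f : PowerSeries K) (c : K) : PowerSeries K :=
  (PowerSeries.exp K).subst (c • PowerSeries.logOf f)

end ReflTutte

end

/-! The proof is a complex analogue of the finite field method. Let `T ⊆ ℂ` consist of `0` and `k`
free orbits of the `m`-th roots of unity, so `#T = 1 + mk`. Every intersection of hyperplanes of the
arrangement expresses each coordinate as zero or a root of unity times a free coordinate
(`MonomialRetract`), so it contains exactly `(#T)^dim` points of `T^n`. Counting pairs
(subarrangement, point of `T^n` on all its hyperplanes) in two ways gives `∑_B (1 + mk)^(n - rk B)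
(y - 1)^#B = ∑_t y^h(t)`, where `h(t)` is the number of hyperplanes through `t`
(`sum_powerset_arrangement`).

The number `h(t)` depends only on how many coordinates of `t` lie in each orbit, so the exponential
formula turns the right side into a coefficient of a series for the orbit `0` times the `k`-th power
of a series for a free orbit. Both sides are polynomial in `k`, so `k` may be any scalar `c`
(`sum_powerset_arrangement_eq`). The choice `1 + mc = (x - 1)(y - 1)` makes the left side `(y -
1)^n` times the Tutte polynomial, provided that the arrangement has rank `n`. The one exception is
`G(m,m,1)`, whose arrangement is empty; this explains the convention there. -/

noncomputable section

namespace ReflTutte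

/-! ### Powers of formal series with arbitrary exponent. -/

section Series

open PowerSeries

variable {K : Type*} [Field K] [CharZero K]

theorem derivative_logOf_mul {f : PowerSeries K} (hf : constantCoeff f = 1) :
    d⁄dX K (logOf f) * f = d⁄dX K f := by
  have hs : HasSubst (f - 1) := HasSubst.of_constantCoeff_zero' (by simp [hf])
  have h1 : d⁄dX K (log K) * (1 + X) = 1 := by
    rw [deriv_log]
    ext n
    rw [mul_add, mul_one, map_add]
    cases n with
    | zero => simp
    | succ n => rw [coeff_succ_mul_X]; simp [pow_succ, coeff_one]
  have h2 := congrArg (PowerSeries.subst (f - 1)) h1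
  have h3 : PowerSeries.subst (f - 1) (1 : PowerSeries K) = 1 := by
    rw [← coe_substAlgHom hs, map_one]
  rw [subst_mul hs, subst_add hs, subst_X hs, h3, add_sub_cancel] at h2
  rw [logOf_eq, derivative_subst hs, map_sub, Derivation.map_one_eq_zero, sub_zero, mul_right_comm,
    h2, one_mul]

theorem hasSubst_smul_logOf {f : PowerSeries K} (hf : constantCoeff f = 1) (c : K) :
    HasSubst (c • logOf f) :=
  HasSubst.of_constantCoeff_zero' (by
    rw [constantCoeff_smul, constantCoeff_logOf hf, smul_zero])

theorem constantCoeff_seriesPow {f : PowerSeries K} (hf : constantCoeff f = 1) (c : K) :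
    constantCoeff (seriesPow f c) = 1 := by
  have hL : constantCoeff (c • logOf f) = 0 := by
    rw [constantCoeff_smul, constantCoeff_logOf hf, smul_zero]
  rw [seriesPow, ← coeff_zero_eq_constantCoeff_apply,
    coeff_subst' (hasSubst_smul_logOf hf c), finsum_eq_single _ 0]
  · simp
  · intro d hd
    simp [hL, hd]

theorem derivative_seriesPow_mul {f : PowerSeries K} (hf : constantCoeff f = 1) (c : K) :
    d⁄dX K (seriesPow f c) * f = c • (seriesPow f c * d⁄dX K f) := by
  rw [seriesPow, derivative_subst (hasSubst_smul_logOf hf c), derivative_exp, Derivation.map_smul,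
    mul_assoc, smul_mul_assoc, derivative_logOf_mul hf, mul_smul_comm]

/-- Both sides solve `f g' = k f' g` with constant term `1`, so their quotient has derivative zero.
-/
theorem seriesPow_natCast {f : PowerSeries K} (hf : constantCoeff f = 1) (k : ℕ) :
    seriesPow f (k : K) = f ^ k := by
  have hf0 : f ≠ 0 := by
    rintro rfl
    simp at hf
  have hinv : (f ^ k)⁻¹ * f ^ k = 1 := PowerSeries.inv_mul_cancel _ (by simp [hf])
  set w : PowerSeries K := seriesPow f (k : K) * (f ^ k)⁻¹ with hw
  have hwf : seriesPow f (k : K) = w * f ^ k := by rw [hw, mul_assoc, hinv, mul_one]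
  have hd := derivative_seriesPow_mul hf (k : K)
  have hw' : d⁄dX K w * f ^ (k + 1) = 0 := by
    rw [hwf, Derivation.leibniz, Derivation.leibniz_pow] at hd
    simp only [smul_eq_mul, nsmul_eq_mul, smul_eq_C_mul, map_natCast] at hd
    cases k with
    | zero => simpa [mul_comm] using hd
    | succ k =>
      simp only [Nat.add_sub_cancel] at hd
      linear_combination hd
  have hw0 : d⁄dX K w = 0 := (mul_eq_zero.mp hw').resolve_right (pow_ne_zero _ hf0)
  have hw1 : w = 1 := by
    refine derivative.ext (by simpa using hw0) ?_
    rw [hw, map_mul, constantCoeff_seriesPow hf, constantCoeff_inv]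
    simp [hf]
  rw [hwf, hw1, one_mul]

/-- Since `logOf f` has no constant term, only its powers of degree at most `n` reach the `n`-th
coefficient, and the `d`-th one carries `c ^ d`. This polynomiality allows natural exponents to be
replaced by arbitrary ones. -/
theorem exists_polynomial_coeff_mul_seriesPow (g : PowerSeries K) {f : PowerSeries K}
    (hf : constantCoeff f = 1) (n : ℕ) :
    ∃ P : Polynomial K, ∀ c : K, P.eval c = coeff n (g * seriesPow f c) := by
  have key : ∀ n : ℕ, ∃ P : Polynomial K, ∀ c : K, P.eval c = coeff n (seriesPow f c) := by
    intro n
    refine ⟨∑ d ∈ Finset.range (n + 1),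
      Polynomial.C (coeff d (exp K) * coeff n (logOf f ^ d)) * Polynomial.X ^ d, fun c => ?_⟩
    rw [seriesPow, coeff_subst' (hasSubst_smul_logOf hf c),
      finsum_eq_finsetSum_of_support_subset (s := Finset.range (n + 1)), Polynomial.eval_finsetSum]
    · refine Finset.sum_congr rfl fun d _ => ?_
      rw [smul_pow, coeff_smul, Polynomial.eval_mul, Polynomial.eval_C, Polynomial.eval_pow,
        Polynomial.eval_X, smul_eq_mul, smul_eq_mul]
      ring
    · intro d hd
      by_contra hdn
      refine hd ?_
      have hdn' : n < d := by simpa using hdn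
      have hX : (X : PowerSeries K) ^ d ∣ logOf f ^ d :=
        pow_dvd_pow_of_dvd (X_dvd_iff.mpr (constantCoeff_logOf hf)) d
      change coeff d (exp K) • coeff n ((c • logOf f) ^ d) = 0
      rw [smul_pow, coeff_smul, X_pow_dvd_iff.mp hX n hdn', smul_zero, smul_zero]
  choose P hP using key
  refine ⟨∑ ij ∈ Finset.HasAntidiagonal.antidiagonal n, Polynomial.C (coeff ij.1 g) * P ij.2, fun c => ?_⟩
  rw [coeff_mul, Polynomial.eval_finsetSum]
  exact Finset.sum_congr rfl fun ij _ => by rw [Polynomial.eval_mul, Polynomial.eval_C, hP]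

end Series

/-! ### Intersections of hyperplanes as monomial graphs over free coordinates. -/

section Retract

variable {n : ℕ}

/-- The subspace `x i = a * x j` of `ℂⁿ`. -/
def coordHyperplane (i j : Fin n) (a : ℂ) : Submodule ℂ (Space n) where
  carrier := {x | x i = a * x j}
  add_mem' := by
    intro x y hx hy
    simp only [Set.mem_ofPred_eq, PiLp.add_apply] at *
    rw [hx, hy, mul_add]
  zero_mem' := by simp
  smul_mem' := by
    intro b x hx
    simp only [Set.mem_ofPred_eq, PiLp.smul_apply, smul_eq_mul] at *
    rw [hx]
    ring

@[simp]
theorem mem_coordHyperplane {i j : Fin n} {a : ℂ} {x : Space n} :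
    x ∈ coordHyperplane i j a ↔ x i = a * x j := Iff.rfl

/-- `W` is the image of the retraction `y ↦ (c i * y (r i))ᵢ`, whose coordinates in `R` are free and
whose coefficients are zero or `m`-th roots of unity. -/
structure MonomialRetract (m : ℕ) (W : Submodule ℂ (Space n)) (R : Finset (Fin n))
    (r : Fin n → Fin n) (c : Fin n → ℂ) : Prop where
  fix : ∀ x ∈ W, ∀ i, x i = c i * x (r i)
  mem : ∀ y : Fin n → ℂ, WithLp.toLp 2 (fun i => c i * y (r i)) ∈ W
  free : ∀ j ∈ R, r j = j ∧ c j = 1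
  supp : ∀ i, c i ≠ 0 → r i ∈ R
  root : ∀ i, c i = 0 ∨ c i ^ m = 1

variable {m : ℕ} {W : Submodule ℂ (Space n)} {R : Finset (Fin n)} {r : Fin n → Fin n}
  {c : Fin n → ℂ}

theorem monomialRetract_top (n m : ℕ) :
    MonomialRetract m (⊤ : Submodule ℂ (Space n)) Finset.univ id (fun _ => 1) where
  fix := by simp
  mem := by simp
  free := by simp
  supp := by simp
  root := by simp

/-- Elimination of the free coordinate `k`: each occurrence of `x k` is replaced by `γ * x l`. -/
theorem MonomialRetract.subst (h : MonomialRetract m W R r c) {k l : Fin n} {γ : ℂ}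
    (hk : k ∈ R) (hγ : γ = 0 ∨ γ ^ m = 1) (hl : γ ≠ 0 → l ∈ R ∧ l ≠ k) :
    MonomialRetract m (W ⊓ coordHyperplane k l γ) (R.erase k)
      (fun i => if r i = k then l else r i) (fun i => if r i = k then c i * γ else c i) where
  fix := by
    rintro x ⟨hxW, hx⟩ i
    have hx' : x k = γ * x l := hx
    have hi := h.fix x hxW i
    by_cases hik : r i = k
    · simp only [hik, if_true]
      rw [hi, hik, hx', mul_assoc]
    · simpa only [hik, if_false] using hi
  mem := by
    intro y
    have e : (fun i => (if r i = k then c i * γ else c i) * y (if r i = k then l else r i)) =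
        fun i => c i * Function.update y k (γ * y l) (r i) := by
      funext i
      by_cases hik : r i = k
      · simp [hik, mul_assoc]
      · simp [hik]
    refine ⟨?_, ?_⟩
    · rw [e]
      exact h.mem _
    · obtain ⟨hk1, hk2⟩ := h.free k hk
      by_cases h0 : γ = 0
      · simp [hk1, h0]
      · obtain ⟨hlR, hlk⟩ := hl h0
        obtain ⟨hl1, hl2⟩ := h.free l hlR
        simp [hk1, hk2, hl1, hl2, hlk]
  free := by
    intro j hj
    obtain ⟨hjk, hjR⟩ := Finset.mem_erase.mp hj
    obtain ⟨h1, h2⟩ := h.free j hjR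
    simp [h1, h2, hjk]
  supp := by
    intro i hi
    by_cases hik : r i = k
    · simp only [hik, if_true] at hi ⊢
      obtain ⟨hlR, hlk⟩ := hl (right_ne_zero_of_mul hi)
      exact Finset.mem_erase.mpr ⟨hlk, hlR⟩
    · simp only [hik, if_false] at hi ⊢
      exact Finset.mem_erase.mpr ⟨hik, h.supp i hi⟩
  root := by
    intro i
    by_cases hik : r i = k
    · simp only [hik, if_true]
      rcases h.root i with h0 | h1
      · exact Or.inl (by rw [h0, zero_mul])
      · rcases hγ with g0 | g1
        · exact Or.inl (by rw [g0, mul_zero])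
        · exact Or.inr (by rw [mul_pow, h1, g1, one_mul])
    · simpa only [hik, if_false] using h.root i

/-- On `W` the new equation reads `c i * x (r i) = a * c j * x (r j)`. It is vacuous, or makes one
free coordinate vanish, or ties two free coordinates by a root of unity, so at most one free
coordinate is lost. -/
theorem MonomialRetract.exists_inf (h : MonomialRetract m W R r c) (i j : Fin n) {a : ℂ}
    (ha : a = 0 ∨ a ^ m = 1) :
    ∃ R' r' c', MonomialRetract m (W ⊓ coordHyperplane i j a) R' r' c' ∧
      R.card ≤ R'.card + 1 := by
  have reduce : ∀ (k l : Fin n) (γ : ℂ), k ∈ R → (γ = 0 ∨ γ ^ m = 1) →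
      (γ ≠ 0 → l ∈ R ∧ l ≠ k) →
      (∀ x ∈ W, x i = a * x j ↔ x k = γ * x l) →
      ∃ R' r' c', MonomialRetract m (W ⊓ coordHyperplane i j a) R' r' c' ∧
        R.card ≤ R'.card + 1 := by
    intro k l γ hk hγ hl hiff
    have e : W ⊓ coordHyperplane i j a = W ⊓ coordHyperplane k l γ := by
      ext x
      simp only [Submodule.mem_inf, mem_coordHyperplane]
      exact and_congr_right fun hx => hiff x hx
    rw [e]
    exact ⟨_, _, _, h.subst hk hγ hl, by rw [Finset.card_erase_of_mem hk]; omega⟩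
  have same : (∀ x ∈ W, x i = a * x j) →
      ∃ R' r' c', MonomialRetract m (W ⊓ coordHyperplane i j a) R' r' c' ∧
        R.card ≤ R'.card + 1 := by
    intro hall
    have e : W ⊓ coordHyperplane i j a = W := inf_eq_left.mpr fun x hx => hall x hx
    rw [e]
    exact ⟨R, r, c, h, Nat.le_succ _⟩
  have hβ : a * c j = 0 ∨ (a * c j) ^ m = 1 := by
    rcases ha with h0 | h1
    · exact Or.inl (by rw [h0, zero_mul])
    · rcases h.root j with g0 | g1
      · exact Or.inl (by rw [g0, mul_zero])
      · exact Or.inr (by rw [mul_pow, h1, g1, one_mul])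
  have hx : ∀ x ∈ W, x i = a * x j ↔ c i * x (r i) = (a * c j) * x (r j) := by
    intro x hxW
    rw [h.fix x hxW i, h.fix x hxW j, mul_assoc]
  by_cases hα : c i = 0
  · by_cases hb : a * c j = 0
    · exact same fun x hxW => (hx x hxW).mpr (by rw [hα, hb, zero_mul, zero_mul])
    · refine reduce (r j) (r j) 0 (h.supp j (right_ne_zero_of_mul hb)) (Or.inl rfl)
        (fun h0 => absurd rfl h0) fun x hxW => ?_
      rw [hx x hxW, hα, zero_mul, zero_mul, eq_comm, mul_eq_zero, or_iff_right hb]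
  · have hk := h.supp i hα
    have hα1 := (h.root i).resolve_left hα
    by_cases hb : a * c j = 0
    · refine reduce (r i) (r i) 0 hk (Or.inl rfl) (fun h0 => absurd rfl h0) fun x hxW => ?_
      rw [hx x hxW, hb, zero_mul, zero_mul, mul_eq_zero, or_iff_right hα]
    · have hl := h.supp j (right_ne_zero_of_mul hb)
      have hβ1 := hβ.resolve_left hb
      by_cases hkl : r j = r i
      · by_cases hab : c i = a * c j
        · exact same fun x hxW => (hx x hxW).mpr (by rw [hab, hkl])
        · refine reduce (r i) (r i) 0 hk (Or.inl rfl) (fun h0 => absurd rfl h0) fun x hxW => ?_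
          rw [hx x hxW, hkl, zero_mul, ← sub_eq_zero, ← sub_mul, mul_eq_zero,
            or_iff_right (sub_ne_zero.mpr hab)]
      · refine reduce (r i) (r j) (a * c j / c i) hk
          (Or.inr (by rw [div_pow, hβ1, hα1, div_one])) (fun _ => ⟨hl, hkl⟩) fun x hxW => ?_
        rw [hx x hxW]
        constructor
        · intro e
          rw [div_mul_eq_mul_div, ← e, mul_div_cancel_left₀ _ hα]
        · intro e
          rw [e]
          field_simp

/-- The cardinality bound is what later yields `rk B ≤ #B`, so that no exponent truncates. -/
theorem exists_monomialRetract (m : ℕ) (B : Finset (Submodule ℂ (Space n)))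
    (hB : ∀ H ∈ B, ∃ i j a, (a = 0 ∨ a ^ m = 1) ∧ H = coordHyperplane i j a) :
    ∃ R r c, MonomialRetract m (B.inf id) R r c ∧ n ≤ R.card + B.card := by
  classical
  induction B using Finset.induction_on with
  | empty => exact ⟨_, _, _, monomialRetract_top n m, by simp⟩
  | insert H B hH ih =>
    obtain ⟨R, r, c, h, hcard⟩ := ih fun H' hH' => hB H' (Finset.mem_insert_of_mem hH')
    obtain ⟨i, j, a, ha, rfl⟩ := hB H (Finset.mem_insert_self _ _)
    obtain ⟨R', r', c', h', hcard'⟩ := h.exists_inf i j ha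
    refine ⟨R', r', c', ?_, ?_⟩
    · rw [Finset.inf_insert, id, inf_comm]
      exact h'
    · rw [Finset.card_insert_of_notMem hH]
      omega

theorem MonomialRetract.finrank_eq (h : MonomialRetract m W R r c) :
    Module.finrank ℂ W = R.card := by
  classical
  let f : W →ₗ[ℂ] (R → ℂ) :=
    { toFun := fun x j => (x : Space n) j
      map_add' := fun _ _ => rfl
      map_smul' := fun _ _ => rfl }
  have hf : Function.Bijective f := by
    constructor
    · intro x y hxy
      ext i
      rw [h.fix x x.2 i, h.fix y y.2 i]
      by_cases hc : c i = 0
      · rw [hc, zero_mul, zero_mul]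
      · exact congrArg _ (congrFun hxy ⟨r i, h.supp i hc⟩)
    · intro y
      refine ⟨⟨_, h.mem fun i => if hi : i ∈ R then y ⟨i, hi⟩ else 0⟩, ?_⟩
      funext j
      obtain ⟨h1, h2⟩ := h.free j j.2
      change c j * (if hi : r j ∈ R then y ⟨r j, hi⟩ else 0) = y j
      simp [h1, h2]
  rw [(LinearEquiv.ofBijective f hf).finrank_eq]
  simp

/-- As for the dimension, restriction to the coordinates in `R` is bijective; surjectivity needs
only that the image of `φ` contains `0` and is stable under `m`-th roots of unity. -/
theorem MonomialRetract.card_points (h : MonomialRetract m W R r c) {T : Type*} [Fintype T]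
    {φ : T → ℂ} (hφ : Function.Injective φ) (h0 : ∃ t, φ t = 0)
    (hroot : ∀ (ζ : ℂ) (t : T), ζ ^ m = 1 → ∃ t', φ t' = ζ * φ t) :
    Nat.card {t : Fin n → T // WithLp.toLp 2 (fun i => φ (t i)) ∈ W} =
      Fintype.card T ^ R.card := by
  classical
  let f : {t : Fin n → T // WithLp.toLp 2 (fun i => φ (t i)) ∈ W} → (R → T) := fun t j => t.1 j
  have hf : Function.Bijective f := by
    constructor
    · intro s t hst
      ext i
      apply hφ
      have hs : φ (s.1 i) = c i * φ (s.1 (r i)) := h.fix _ s.2 i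
      have ht : φ (t.1 i) = c i * φ (t.1 (r i)) := h.fix _ t.2 i
      rw [hs, ht]
      by_cases hc : c i = 0
      · rw [hc, zero_mul, zero_mul]
      · exact congrArg (fun u => c i * φ u) (congrFun hst ⟨r i, h.supp i hc⟩)
    · intro s
      obtain ⟨t0, ht0⟩ := h0
      have key : ∀ i, ∃ t, φ t = c i * φ (if hi : r i ∈ R then s ⟨r i, hi⟩ else t0) := by
        intro i
        rcases h.root i with hc | hc
        · exact ⟨t0, by rw [ht0, hc, zero_mul]⟩
        · exact hroot _ _ hc
      choose t ht using key
      refine ⟨⟨t, ?_⟩, ?_⟩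
      · simp only [ht]
        exact h.mem fun i => φ (if hi : i ∈ R then s ⟨i, hi⟩ else t0)
      · funext j
        apply hφ
        obtain ⟨h1, h2⟩ := h.free j j.2
        change φ (t j) = _
        rw [ht, h2, one_mul]
        simp [h1]
  rw [Nat.card_congr (Equiv.ofBijective f hf)]
  simp

end Retract

/-! ### The reflection hyperplanes of the groups `G(m,p,n)`. -/

section Arrangement

variable {n : ℕ}

theorem single_mem_coordHyperplane {i j l : Fin n} {a : ℂ} (hij : i ≠ j) (ha : a ≠ 0) :
    EuclideanSpace.single l (1 : ℂ) ∈ coordHyperplane i j a ↔ l ≠ i ∧ l ≠ j := by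
  rw [mem_coordHyperplane, PiLp.single_apply, PiLp.single_apply]
  by_cases hi : i = l
  · subst hi
    simp [hij.symm]
  · by_cases hj : j = l
    · subst hj
      simp [hi, ha.symm]
    · simp [hi, hj, Ne.symm hi, Ne.symm hj]

theorem single_mem_coordHyperplane_self {i l : Fin n} {a : ℂ} (ha : a ≠ 1) :
    EuclideanSpace.single l (1 : ℂ) ∈ coordHyperplane i i a ↔ l ≠ i := by
  rw [mem_coordHyperplane, PiLp.single_apply]
  by_cases hi : i = l
  · subst hi
    simp [ha.symm]
  · simp [hi, Ne.symm hi]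

/-- The standard basis vectors missing from the hyperplane are those at `i` and `j`, which recovers
the pair. -/
theorem coordHyperplane_injOn {i j i' j' : Fin n} {a a' : ℂ} (hij : i < j) (hij' : i' < j')
    (ha : a ≠ 0) (ha' : a' ≠ 0) (h : coordHyperplane i j a = coordHyperplane i' j' a') :
    i = i' ∧ j = j' ∧ a = a' := by
  have key : ∀ l, (l ≠ i ∧ l ≠ j) ↔ (l ≠ i' ∧ l ≠ j') := fun l => by
    rw [← single_mem_coordHyperplane hij.ne ha, h, single_mem_coordHyperplane hij'.ne ha']
  have h1 := key i
  have h2 := key j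
  have h3 := key i'
  have h4 := key j'
  have hi : i = i' := by grind
  have hj : j = j' := by grind
  subst hi hj
  refine ⟨rfl, rfl, ?_⟩
  -- The vector `a e_i + e_j` lies on the hyperplane and determines the ratio `a`.
  have hv : WithLp.toLp 2 (fun l => if l = i then a else if l = j then 1 else 0) ∈
      coordHyperplane i j a := by
    simp [hij.ne']
  rw [h] at hv
  simpa [hij.ne'] using hv

theorem coordHyperplane_swap {i j : Fin n} {a : ℂ} (ha : a ≠ 0) :
    coordHyperplane i j a = coordHyperplane j i a⁻¹ := by
  ext x
  rw [mem_coordHyperplane, mem_coordHyperplane, eq_inv_mul_iff_mul_eq₀ ha, eq_comm]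

theorem coordHyperplane_self {i : Fin n} {a : ℂ} (ha : a ≠ 1) :
    coordHyperplane i i a = coordHyperplane i i 0 := by
  ext x
  rw [mem_coordHyperplane, mem_coordHyperplane, zero_mul]
  constructor
  · intro h
    have : (1 - a) * x i = 0 := by linear_combination h
    exact (mul_eq_zero.mp this).resolve_left (sub_ne_zero.mpr ha.symm)
  · intro h
    rw [h, mul_zero]

section Reflection

variable {f : Space n →ₗ[ℂ] Space n} {u : Space n} {ξ : ℂ}

/-- As `x - f x` is a multiple of `u`, it vanishes as soon as one coordinate in the support of `u`
does. -/
theorem mem_ker_reflection (hu : u ≠ 0)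
    (hf : ∀ x, f x = x - ((1 - ξ) * (inner ℂ u x / inner ℂ u u)) • u) (x : Space n) (k : Fin n)
    (hk : u k ≠ 0) :
    x ∈ LinearMap.ker (1 - f) ↔ x k = f x k := by
  rw [LinearMap.mem_ker, LinearMap.sub_apply, Module.End.one_apply, hf, sub_sub_cancel,
    PiLp.sub_apply, PiLp.smul_apply, smul_eq_mul, eq_comm (a := x k), sub_eq_self, smul_eq_zero,
    mul_eq_zero (b := u k), or_iff_left hu, or_iff_left hk]

theorem notMem_ker_reflection (hu : u ≠ 0) (hξ : ξ ≠ 1)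
    (hf : ∀ x, f x = x - ((1 - ξ) * (inner ℂ u x / inner ℂ u u)) • u) :
    u ∉ LinearMap.ker (1 - f) := by
  rw [LinearMap.mem_ker, LinearMap.sub_apply, Module.End.one_apply, hf, sub_sub_cancel,
    div_self (inner_self_ne_zero.mpr hu), mul_one, smul_eq_zero, not_or]
  exact ⟨sub_ne_zero.mpr hξ.symm, hu⟩

theorem ker_reflection_eq (hu : u ≠ 0)
    (hf : ∀ x, f x = x - ((1 - ξ) * (inner ℂ u x / inner ℂ u u)) • u)
    {σ : Equiv.Perm (Fin n)} {θ : Fin n → ℂˣ} (hσ : ∀ x i, f x i = θ i * x (σ i)) {k : Fin n}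
    (hk : u k ≠ 0) :
    LinearMap.ker (1 - f) = coordHyperplane k (σ k) (θ k) := by
  ext x
  rw [mem_ker_reflection hu hf x k hk, hσ, mem_coordHyperplane]

end Reflection

/-- The linear automorphism with `(g x) i = θ i * x (σ i)`. -/
def monomialGL (σ : Equiv.Perm (Fin n)) (θ : Fin n → ℂˣ) : GLSpace n where
  val :=
    { toFun := fun x => WithLp.toLp 2 fun i => (θ i : ℂ) * x (σ i)
      map_add' := fun x y => by ext i; simp [mul_add]
      map_smul' := fun a x => by ext i; simp [mul_left_comm] }
  inv :=
    { toFun := fun x => WithLp.toLp 2 fun i => ((θ (σ.symm i))⁻¹ : ℂ) * x (σ.symm i)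
      map_add' := fun x y => by ext i; simp [mul_add]
      map_smul' := fun a x => by ext i; simp [mul_left_comm] }
  val_inv := by ext x i; simp
  inv_val := by ext x i; simp

theorem monomialGL_apply (σ : Equiv.Perm (Fin n)) (θ : Fin n → ℂˣ) (x : Space n) (i : Fin n) :
    (monomialGL σ θ : Space n →ₗ[ℂ] Space n) x i = θ i * x (σ i) := rfl

variable {m p : ℕ}

theorem coordHyperplane_mem_arrangementSet {i j : Fin n} (hij : i ≠ j) {ζ : ℂˣ} (hm : m ≠ 0)
    (hζ : ζ ^ m = 1) :
    coordHyperplane i j ζ ∈ arrangementSet (imprimitiveGroup m p n) := by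
  -- A transposition twisted by `ζ` and `ζ⁻¹`: the product of entries is `1`, so it lies in the
  -- group for every `p`.
  set θ : Fin n → ℂˣ := fun l => if l = i then ζ else if l = j then ζ⁻¹ else 1 with hθ
  have hprod : ∏ l, θ l = 1 := by
    rw [← Finset.prod_subset (Finset.subset_univ {i, j}), Finset.prod_pair hij]
    · simp [hθ, hij.symm]
    · intro l _ hl
      simp only [Finset.mem_insert, Finset.mem_singleton, not_or] at hl
      simp [hθ, hl]
  have hconj : (starRingEnd ℂ) (ζ : ℂ)⁻¹ = ζ := by
    have hn : ‖(ζ : ℂ)‖ = 1 := Complex.norm_eq_one_of_pow_eq_one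
      (by rw [← Units.val_pow_eq_pow_val, hζ, Units.val_one]) hm
    rw [Complex.inv_eq_conj hn, Complex.conj_conj]
  -- The normal vector is `e_i - ζ⁻¹ e_j`, because the conjugate of `ζ⁻¹` is `ζ`; the reflection has
  -- order two.
  set u : Space n := WithLp.toLp 2 fun l => if l = i then 1 else if l = j then -(ζ : ℂ)⁻¹ else 0
    with hu
  have hui : u i = 1 := by simp [hu]
  have huj : u j = -(ζ : ℂ)⁻¹ := by simp [hu, hij.symm]
  have hu0 : u ≠ 0 := by
    intro h
    rw [h] at hui
    simp at hui
  have hinner : ∀ x : Space n, inner ℂ u x = x i - ζ * x j := by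
    intro x
    rw [PiLp.inner_apply, ← Finset.sum_subset (Finset.subset_univ {i, j}), Finset.sum_pair hij,
      hui, huj]
    · simp only [RCLike.inner_apply, map_neg, hconj, map_one]
      ring
    · intro l _ hl
      simp only [Finset.mem_insert, Finset.mem_singleton, not_or] at hl
      simp [hu, hl]
  have hrefl : ∀ x, (monomialGL (Equiv.swap i j) θ : Space n →ₗ[ℂ] Space n) x =
      x - ((1 - (-1 : ℂ)) * (inner ℂ u x / inner ℂ u u)) • u := by
    intro x
    have h2 : inner ℂ u u = (2 : ℂ) := by
      rw [hinner, hui, huj, mul_neg, mul_inv_cancel₀ ζ.ne_zero]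
      norm_num
    ext l
    rw [monomialGL_apply, PiLp.sub_apply, PiLp.smul_apply, h2, hinner, smul_eq_mul]
    by_cases hli : l = i
    · subst hli
      rw [hui, Equiv.swap_apply_left]
      simp [hθ]
      ring
    · by_cases hlj : l = j
      · subst hlj
        rw [huj, Equiv.swap_apply_right]
        have := ζ.ne_zero
        simp [hθ, hli]
        field_simp
        ring
      · rw [Equiv.swap_apply_of_ne_of_ne hli hlj]
        simp [hθ, hu, hli, hlj]
  refine ⟨monomialGL (Equiv.swap i j) θ, ⟨Equiv.swap i j, θ, fun l => ?_, ?_,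
    monomialGL_apply _ _⟩, ⟨u, -1, hu0, by norm_num, ⟨2, by norm_num⟩, hrefl⟩, ?_⟩
  · simp only [hθ]
    split_ifs <;> simp [hζ]
  · rw [hprod, one_pow]
  · rw [ker_reflection_eq hu0 hrefl (monomialGL_apply _ _) (k := i)
      (by rw [hui]; exact one_ne_zero), Equiv.swap_apply_left]
    simp [hθ]

theorem coordHyperplane_self_mem_arrangementSet (i : Fin n) (hm : m ≠ 0) (hpm : p ∣ m)
    (hmp : m ≠ p) :
    coordHyperplane i i 0 ∈ arrangementSet (imprimitiveGroup m p n) := by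
  obtain ⟨d, rfl⟩ := hpm
  have hp0 : p ≠ 0 := left_ne_zero_of_mul hm
  have hd0 : d ≠ 0 := right_ne_zero_of_mul hm
  have hd1 : d ≠ 1 := fun h => hmp (by rw [h, mul_one])
  have hdiv : p * d / p = d := Nat.mul_div_cancel_left d (Nat.pos_of_ne_zero hp0)
  have hprim := Complex.isPrimitiveRoot_exp d hd0
  -- With `d = m / p ≥ 2`, scaling one coordinate by a primitive `d`-th root of unity is allowed and
  -- nontrivial.
  obtain ⟨ζ, hζ⟩ : ∃ ζ : ℂˣ, (ζ : ℂ) = Complex.exp (2 * Real.pi * Complex.I / d) :=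
    ⟨Units.mk0 _ (Complex.exp_ne_zero _), rfl⟩
  rw [← hζ] at hprim
  have hζ1 : (ζ : ℂ) ≠ 1 := hprim.ne_one (by omega)
  have hζd : ζ ^ d = 1 := Units.ext (by
    rw [Units.val_pow_eq_pow_val, hprim.pow_eq_one, Units.val_one])
  set θ : Fin n → ℂˣ := Function.update 1 i ζ with hθ
  have hu0 : EuclideanSpace.single i (1 : ℂ) ≠ 0 := by simp
  have hrefl : ∀ x, (monomialGL 1 θ : Space n →ₗ[ℂ] Space n) x =
      x - ((1 - (ζ : ℂ)) * (inner ℂ (EuclideanSpace.single i (1 : ℂ)) x /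
        inner ℂ (EuclideanSpace.single i (1 : ℂ)) (EuclideanSpace.single i (1 : ℂ)))) •
          EuclideanSpace.single i (1 : ℂ) := by
    intro x
    ext l
    rw [monomialGL_apply]
    by_cases hl : l = i
    · subst hl
      simp [hθ, EuclideanSpace.inner_single_left]
      ring
    · simp [hθ, hl, EuclideanSpace.inner_single_left]
  refine ⟨monomialGL 1 θ, ⟨1, θ, fun l => ?_, ?_, monomialGL_apply _ _⟩,
    ⟨EuclideanSpace.single i 1, ζ, hu0, hζ1, ⟨d, Nat.pos_of_ne_zero hd0, hprim.pow_eq_one⟩, hrefl⟩,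
    ?_⟩
  · by_cases hl : l = i
    · subst hl
      simp [hθ, mul_comm p d, pow_mul, hζd]
    · simp [hθ, hl]
  · rw [hθ, Finset.prod_update_of_mem (Finset.mem_univ i), hdiv]
    simp [hζd]
  · rw [ker_reflection_eq hu0 hrefl (monomialGL_apply _ _) (k := i) (by simp),
      Equiv.Perm.one_apply, coordHyperplane_self (a := (θ i : ℂ))]
    simpa [hθ] using hζ1

theorem mem_arrangementSet_imprimitiveGroup {H : Submodule ℂ (Space n)} (hm : m ≠ 0)
    (hpm : p ∣ m) :
    H ∈ arrangementSet (imprimitiveGroup m p n) ↔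
      (∃ (i j : Fin n) (ζ : ℂˣ), i < j ∧ ζ ^ m = 1 ∧ H = coordHyperplane i j ζ) ∨
        (m ≠ p ∧ ∃ i : Fin n, H = coordHyperplane i i 0) := by
  constructor
  · rintro ⟨g, ⟨σ, θ, hθm, hθp, hσ⟩, ⟨u, ξ, hu, hξ, -, hf⟩, rfl⟩
    obtain ⟨k, hk⟩ : ∃ k, u k ≠ 0 := by
      by_contra! h
      exact hu (by ext k; exact h k)
    have hker := ker_reflection_eq hu hf hσ hk
    rcases lt_trichotomy (σ k) k with hlt | heq | hgt
    · refine Or.inl ⟨σ k, k, (θ k)⁻¹, hlt, by rw [inv_pow, hθm, inv_one], ?_⟩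
      rw [hker, coordHyperplane_swap (θ k).ne_zero, Units.val_inv_eq_inv_val]
    · have hθk : θ k ≠ 1 := by
        intro h1
        refine notMem_ker_reflection hu hξ hf ?_
        rw [hker, mem_coordHyperplane, heq, h1, Units.val_one, one_mul]
      refine Or.inr ⟨?_, k, ?_⟩
      · rintro rfl
        refine hθk ?_
        -- The fixed hyperplane `x k = θ k * x k` contains every other `e_i`, so the remaining
        -- entries are `1`. For `p = m` the product of all entries is `1`, which forces `θ k = 1`.
        have hother : ∀ i, i ≠ k → θ i = 1 := by
          intro i hik
          have hi : EuclideanSpace.single i (1 : ℂ) ∈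
              LinearMap.ker (1 - (g : Space n →ₗ[ℂ] Space n)) := by
            rw [hker, heq, mem_coordHyperplane]
            simp [hik.symm]
          rw [LinearMap.mem_ker, LinearMap.sub_apply, Module.End.one_apply, sub_eq_zero] at hi
          have hi' := congrArg (fun v : Space n => v i) hi
          simp only [hσ, PiLp.single_apply, if_true] at hi'
          by_cases hs : σ i = i
          · rw [if_pos hs, mul_one] at hi'
            exact Units.ext hi'.symm
          · rw [if_neg hs, mul_zero] at hi'
            exact absurd hi' one_ne_zero
        rw [Nat.div_self (Nat.pos_of_ne_zero hm), pow_one, Finset.prod_eq_single k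
          (fun i _ hik => hother i hik) (fun h => absurd (Finset.mem_univ k) h)] at hθp
        exact hθp
      · rw [hker, heq, coordHyperplane_self]
        exact fun h => hθk (Units.ext h)
    · exact Or.inl ⟨k, σ k, θ k, hgt, hθm k, hker⟩
  · rintro (⟨i, j, ζ, hij, hζ, rfl⟩ | ⟨hmp, i, rfl⟩)
    · exact coordHyperplane_mem_arrangementSet hij.ne hm hζ
    · exact coordHyperplane_self_mem_arrangementSet i hm hpm hmp

end Arrangement

/-! ### Counting hyperplanes through points with coordinates in `T`. -/

section Counting

/-- The exponential formula for words weighted by the multiplicities of their letter classes. -/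
theorem sum_prod_fiber_card {K : Type*} [Field K] [CharZero K] {T ι : Type*} [Fintype T]
    [Fintype ι] [DecidableEq ι] (π : T → ι) (a : ι → ℕ → K) (n : ℕ) :
    ∑ t : Fin n → T, ∏ l, a l (Finset.univ.filter fun i => π (t i) = l).card =
      n.factorial * PowerSeries.coeff n (∏ l, PowerSeries.mk fun j =>
        ((Finset.univ.filter fun s => π s = l).card : K) ^ j * a l j / (j.factorial : K)) := by
  set w : ι → ℕ := fun l => (Finset.univ.filter fun s => π s = l).card with hw
  -- The functional `Λ` replaces the monomial `X ^ d` by the weight `∏ a l (d l)`. It is applied to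
  -- the `n`-th power of `∑ X (π s)`, expanded once over words and once by the multinomial theorem.
  let Λ : MvPolynomial ι K →ₗ[K] K :=
    (MvPolynomial.basisMonomials ι K).constr K fun d => ∏ l, a l (d l)
  have hΛ : ∀ d : ι →₀ ℕ, Λ (MvPolynomial.monomial d 1) = ∏ l, a l (d l) := fun d => by
    have := (MvPolynomial.basisMonomials ι K).constr_basis K (fun d => ∏ l, a l (d l)) d
    rwa [MvPolynomial.coe_basisMonomials] at this
  have hX : ∀ d : ι →₀ ℕ, ∏ l, (MvPolynomial.X l : MvPolynomial ι K) ^ d l =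
      MvPolynomial.monomial d 1 := fun d => by
    rw [MvPolynomial.monomial_eq, map_one, one_mul, Finsupp.prod_fintype _ _ fun _ => pow_zero _]
  have hsum : ∑ s : T, (MvPolynomial.X (π s) : MvPolynomial ι K) =
      ∑ l, MvPolynomial.C (w l : K) * MvPolynomial.X l := by
    rw [← Finset.sum_fiberwise Finset.univ π]
    refine Finset.sum_congr rfl fun l _ => ?_
    rw [Finset.sum_congr rfl fun s hs => by rw [(Finset.mem_filter.mp hs).2], Finset.sum_const,
      nsmul_eq_mul, map_natCast]
  have h1 : Λ ((∑ s : T, (MvPolynomial.X (π s) : MvPolynomial ι K)) ^ n) =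
      ∑ t : Fin n → T, ∏ l, a l (Finset.univ.filter fun i => π (t i) = l).card := by
    rw [Fintype.sum_pow, map_sum]
    refine Finset.sum_congr rfl fun t _ => ?_
    have e : ∏ i, (MvPolynomial.X (π (t i)) : MvPolynomial ι K) =
        MvPolynomial.monomial (Finsupp.equivFunOnFinite.symm fun l =>
          (Finset.univ.filter fun i => π (t i) = l).card) 1 := by
      rw [← hX, ← Finset.prod_fiberwise Finset.univ fun i => π (t i)]
      refine Finset.prod_congr rfl fun l _ => ?_
      rw [Finset.prod_congr rfl fun i hi => by rw [(Finset.mem_filter.mp hi).2], Finset.prod_const]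
      rfl
    rw [e, hΛ]
    rfl
  rw [← h1, hsum, Finset.sum_pow_eq_sum_piAntidiag, map_sum, PowerSeries.coeff_prod,
    Finset.mul_sum]
  refine Finset.sum_bij' (fun k _ => Finsupp.equivFunOnFinite.symm k) (fun d _ => d) ?_ ?_ ?_ ?_ ?_
  · intro k hk
    simpa using hk
  · intro d hd
    simpa using hd
  · intro k _
    rfl
  · intro d _
    ext
    rfl
  · intro k hk
    have hkn : ∑ l, k l = n := (Finset.mem_piAntidiag.mp hk).1
    have hmul : ((∏ l, ((k l).factorial : K)) * Nat.multinomial Finset.univ k : K) =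
        n.factorial := by
      rw [← hkn]
      exact_mod_cast Nat.multinomial_spec Finset.univ k
    have hne : (∏ l, ((k l).factorial : K)) ≠ 0 :=
      Finset.prod_ne_zero_iff.mpr fun l _ => Nat.cast_ne_zero.mpr (Nat.factorial_ne_zero _)
    have e : (Nat.multinomial Finset.univ k : MvPolynomial ι K) *
        ∏ l, (MvPolynomial.C (w l : K) * MvPolynomial.X l) ^ k l =
        ((Nat.multinomial Finset.univ k : K) * ∏ l, (w l : K) ^ k l) •
          MvPolynomial.monomial (Finsupp.equivFunOnFinite.symm k) 1 := by
      rw [← hX, MvPolynomial.smul_eq_C_mul]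
      simp only [mul_pow, Finset.prod_mul_distrib, map_mul, map_prod, map_pow, map_natCast,
        Finsupp.coe_equivFunOnFinite_symm]
      ring
    rw [e, map_smul, hΛ, smul_eq_mul]
    simp only [PowerSeries.coeff_mk, Finsupp.coe_equivFunOnFinite_symm, Finset.prod_div_distrib,
      Finset.prod_mul_distrib]
    rw [← hmul]
    field_simp
    rw [hw]
    ring

variable {n : ℕ}

/-- The number of pairs of positions with equal letters, weighted by the letter. -/
theorem sum_pairs_eq {ι : Type*} [Fintype ι] [DecidableEq ι] (ρ : Fin n → ι) (b : ι → ℕ) :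
    ∑ q : Fin n × Fin n with q.1 < q.2, (if ρ q.1 = ρ q.2 then b (ρ q.1) else 0) =
      ∑ l, b l * (Finset.univ.filter fun i => ρ i = l).card.choose 2 := by
  have h1 : ∀ q : Fin n × Fin n, (if ρ q.1 = ρ q.2 then b (ρ q.1) else 0) =
      ∑ l, if ρ q.1 = l ∧ ρ q.2 = l then b l else 0 := by
    intro q
    rw [Finset.sum_eq_single (ρ q.1)]
    · simp [eq_comm]
    · intro l _ hl
      rw [if_neg fun h => hl h.1.symm]
    · simp
  simp_rw [h1]
  rw [Finset.sum_comm]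
  refine Finset.sum_congr rfl fun l _ => ?_
  rw [← Finset.sum_filter, Finset.sum_const, smul_eq_mul, mul_comm, Finset.filter_filter,
    ← Finset.card_product_filter_lt]
  congr 2
  ext q
  simp [and_comm]

/-- `k` free orbits of the `m`-th roots of unity in `ℂ`, together with the origin. -/
def orbitPoint (m k : ℕ) : Option (Fin k × rootsOfUnity m ℂ) → ℂ
  | none => 0
  | some (l, ζ) => ((ζ : ℂˣ) : ℂ) * ((l : ℕ) + 1 : ℂ)

theorem smul_orbitPoint_some {m k : ℕ} (ω : rootsOfUnity m ℂ) (l : Fin k) (ζ : rootsOfUnity m ℂ) :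
    ((ω : ℂˣ) : ℂ) * orbitPoint m k (some (l, ζ)) = orbitPoint m k (some (l, ω * ζ)) := by
  simp [orbitPoint, mul_assoc]

variable {m p : ℕ} [NeZero m]

instance rootsOfUnityFintype : Fintype (rootsOfUnity m ℂ) := Fintype.ofFinite _

theorem card_rootsOfUnity_complex : Fintype.card (rootsOfUnity m ℂ) = m := by
  rw [← Nat.card_eq_fintype_card, Complex.card_rootsOfUnity]

/-- The hyperplanes of `G(m,m,n)`. -/
def pairHyperplane (q : (Fin n × Fin n) × rootsOfUnity m ℂ) : Submodule ℂ (Space n) :=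
  coordHyperplane q.1.1 q.1.2 ((q.2 : ℂˣ) : ℂ)

open Classical in
theorem arrangement_imprimitiveGroup (hpm : p ∣ m) :
    arrangement (imprimitiveGroup m p n) =
      (((Finset.univ.filter fun q : Fin n × Fin n => q.1 < q.2) ×ˢ
        (Finset.univ : Finset (rootsOfUnity m ℂ))).image pairHyperplane) ∪
      (if m = p then ∅ else Finset.univ.image fun i : Fin n => coordHyperplane i i 0) := by
  ext H
  rw [arrangement, Set.Finite.mem_toFinset,
    mem_arrangementSet_imprimitiveGroup (NeZero.ne m) hpm, Finset.mem_union]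
  refine or_congr ?_ ?_
  · simp only [Finset.mem_image, Finset.mem_product, Finset.mem_filter, Finset.mem_univ, true_and,
      and_true, pairHyperplane]
    constructor
    · rintro ⟨i, j, ζ, hij, hζ, rfl⟩
      exact ⟨((i, j), ⟨ζ, (mem_rootsOfUnity m ζ).mpr hζ⟩), hij, rfl⟩
    · rintro ⟨⟨⟨i, j⟩, ζ⟩, hij, rfl⟩
      exact ⟨i, j, ζ, hij, (mem_rootsOfUnity m _).mp ζ.2, rfl⟩
  · split_ifs with h
    · simp [h]
    · simp [h, eq_comm]

open Classical in
theorem card_hyperplanes_through (hpm : p ∣ m) (z : Space n) :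
    ((arrangement (imprimitiveGroup m p n)).filter fun H => z ∈ H).card =
      (∑ q : Fin n × Fin n with q.1 < q.2,
        (Finset.univ.filter fun ζ : rootsOfUnity m ℂ =>
          z q.1 = ((ζ : ℂˣ) : ℂ) * z q.2).card) +
      (if m = p then 0 else (Finset.univ.filter fun i => z i = 0).card) := by
  rw [arrangement_imprimitiveGroup hpm, Finset.filter_union, Finset.card_union_of_disjoint]
  · congr 1
    · rw [Finset.filter_image, Finset.card_image_of_injOn, Finset.card_filter, Finset.sum_product]
      · simp_rw [Finset.card_filter]
        rfl
      · rintro ⟨⟨i, j⟩, ζ⟩ hq ⟨⟨i', j'⟩, ζ'⟩ hq' h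
        have hij : i < j := by simpa using (Finset.mem_filter.mp hq).1
        have hij' : i' < j' := by simpa using (Finset.mem_filter.mp hq').1
        obtain ⟨rfl, rfl, h3⟩ := coordHyperplane_injOn hij hij' (Units.ne_zero _)
          (Units.ne_zero _) h
        exact congrArg _ (Subtype.ext (Units.ext h3))
    · split_ifs with h
      · simp
      · rw [Finset.filter_image, Finset.card_image_of_injective]
        · simp
        · intro i i' h
          have h1 := single_mem_coordHyperplane_self (i := i) (l := i) zero_ne_one
          rw [show coordHyperplane i i 0 = coordHyperplane i' i' 0 from h,
            single_mem_coordHyperplane_self zero_ne_one] at h1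
          by_contra hne
          exact h1.mp hne rfl
  · rw [Finset.disjoint_left]
    intro H h1 h2
    have h1' := (Finset.mem_filter.mp h1).1
    have h2' := (Finset.mem_filter.mp h2).1
    split_ifs at h2' with h
    · simp at h2'
    · obtain ⟨⟨⟨i, j⟩, ζ⟩, hq, rfl⟩ := Finset.mem_image.mp h1'
      obtain ⟨l, -, hl⟩ := Finset.mem_image.mp h2'
      have hij : i < j := by simpa using hq
      -- A coordinate hyperplane omits exactly one basis vector, a pair hyperplane exactly two.
      have key : ∀ e : Fin n, e ≠ l ↔ e ≠ i ∧ e ≠ j := fun e => by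
        rw [← single_mem_coordHyperplane_self zero_ne_one, hl]
        exact single_mem_coordHyperplane hij.ne (Units.ne_zero _)
      have ki := key i
      have kj := key j
      have := hij.ne
      grind

/-- The modulus tells the orbits apart; this is why the positive integers serve as orbit
representatives. -/
theorem norm_orbitPoint_some {k : ℕ} (l : Fin k) (ζ : rootsOfUnity m ℂ) :
    ‖orbitPoint m k (some (l, ζ))‖ = (l : ℕ) + 1 := by
  have h1 : ‖((ζ : ℂˣ) : ℂ)‖ = 1 := Complex.norm_eq_one_of_pow_eq_one (by
    rw [← Units.val_pow_eq_pow_val, (mem_rootsOfUnity m _).mp ζ.2, Units.val_one]) (NeZero.ne m)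
  rw [orbitPoint, norm_mul, h1, one_mul, ← Nat.cast_succ, Complex.norm_natCast, Nat.cast_succ]

theorem orbitPoint_eq_zero_iff {k : ℕ} (s : Option (Fin k × rootsOfUnity m ℂ)) :
    orbitPoint m k s = 0 ↔ s = none := by
  rcases s with _ | ⟨l, ζ⟩
  · simp [orbitPoint]
  · rw [← norm_eq_zero, norm_orbitPoint_some]
    simp
    positivity

theorem orbitPoint_injective (m k : ℕ) [NeZero m] : Function.Injective (orbitPoint m k) := by
  intro s t h
  rcases s with _ | ⟨l, ζ⟩
  · exact ((orbitPoint_eq_zero_iff t).mp h.symm).symm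
  · rcases t with _ | ⟨l', ζ'⟩
    · exact (orbitPoint_eq_zero_iff _).mp h
    · have hn := congrArg norm h
      rw [norm_orbitPoint_some, norm_orbitPoint_some, add_left_inj, Nat.cast_inj] at hn
      obtain rfl := Fin.ext hn
      have hl : ((l : ℕ) + 1 : ℂ) ≠ 0 := Nat.cast_add_one_ne_zero _
      have hζ : ζ = ζ' := Subtype.ext (Units.ext (mul_right_cancel₀ hl h))
      rw [hζ]

theorem exists_orbitPoint_eq_mul {k : ℕ} (ζ : ℂ) (s : Option (Fin k × rootsOfUnity m ℂ))
    (hζ : ζ ^ m = 1) : ∃ t, orbitPoint m k t = ζ * orbitPoint m k s := by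
  rcases s with _ | ⟨l, ω⟩
  · exact ⟨none, by simp [orbitPoint]⟩
  · refine ⟨some (l, rootsOfUnity.mkOfPowEq ζ hζ * ω), ?_⟩
    rw [← smul_orbitPoint_some, rootsOfUnity.coe_mkOfPowEq]

open Classical in
-- If both points are `0`, every `ζ` works; on a common free orbit exactly one does; otherwise none.
theorem card_ratio_orbitPoint {k : ℕ} (s t : Option (Fin k × rootsOfUnity m ℂ)) :
    (Finset.univ.filter fun ζ : rootsOfUnity m ℂ =>
        orbitPoint m k s = ((ζ : ℂˣ) : ℂ) * orbitPoint m k t).card =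
      if s.map Prod.fst = t.map Prod.fst then (s.map Prod.fst).elim m (fun _ => 1) else 0 := by
  rcases s with _ | ⟨l, ζ⟩ <;> rcases t with _ | ⟨l', ζ'⟩
  · rw [Finset.filter_true_of_mem fun _ _ => by simp [orbitPoint], Finset.card_univ,
      card_rootsOfUnity_complex]
    simp
  · rw [Finset.card_eq_zero.mpr]
    · simp
    · refine Finset.filter_eq_empty_iff.mpr fun ω _ h => ?_
      rw [smul_orbitPoint_some] at h
      simpa using orbitPoint_injective m k h
  · rw [Finset.card_eq_zero.mpr]
    · simp
    · refine Finset.filter_eq_empty_iff.mpr fun ω _ h => ?_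
      have h0 : orbitPoint m k (some (l, ζ)) = 0 := by rw [h]; simp [orbitPoint]
      simpa using (orbitPoint_eq_zero_iff _).mp h0
  · simp_rw [smul_orbitPoint_some, (orbitPoint_injective m k).eq_iff]
    by_cases hl : l = l'
    · subst hl
      simp only [Option.map_some, if_true, Option.elim_some, Finset.card_eq_one]
      refine ⟨ζ * ζ'⁻¹, ?_⟩
      ext ω
      simp [eq_mul_inv_iff_mul_eq, eq_comm]
    · simp [hl]

open Classical in
theorem card_hyperplanes_through_orbitPoint (hpm : p ∣ m) {k : ℕ}
    (t : Fin n → Option (Fin k × rootsOfUnity m ℂ)) :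
    ((arrangement (imprimitiveGroup m p n)).filter fun H =>
        WithLp.toLp 2 (fun i => orbitPoint m k (t i)) ∈ H).card =
      ∑ l : Option (Fin k),
        (l.elim m (fun _ => 1) * (Finset.univ.filter fun i => (t i).map Prod.fst = l).card.choose 2 +
          l.elim (if m = p then 0 else (Finset.univ.filter fun i => (t i).map Prod.fst = l).card)
            (fun _ => 0)) := by
  rw [card_hyperplanes_through hpm, Finset.sum_add_distrib,
    ← sum_pairs_eq (fun i => (t i).map Prod.fst) (fun l => l.elim m (fun _ => 1))]
  congr 1
  · exact Finset.sum_congr rfl fun q _ => card_ratio_orbitPoint _ _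
  · rw [Fintype.sum_option]
    simp [orbitPoint_eq_zero_iff]

end Counting

/-! ### From the point count to the Tutte polynomial. -/

section Tutte

variable {n m p : ℕ} [NeZero m]

theorem exists_coordHyperplane_of_mem_arrangement (hpm : p ∣ m) {H : Submodule ℂ (Space n)}
    (hH : H ∈ arrangement (imprimitiveGroup m p n)) :
    ∃ i j a, (a = 0 ∨ a ^ m = 1) ∧ H = coordHyperplane i j a := by
  rw [arrangement, Set.Finite.mem_toFinset,
    mem_arrangementSet_imprimitiveGroup (NeZero.ne m) hpm] at hH
  rcases hH with ⟨i, j, ζ, -, hζ, rfl⟩ | ⟨-, i, rfl⟩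
  · exact ⟨i, j, ζ, Or.inr (by rw [← Units.val_pow_eq_pow_val, hζ, Units.val_one]), rfl⟩
  · exact ⟨i, i, 0, Or.inl rfl, rfl⟩

theorem exists_retract_of_subset_arrangement (hpm : p ∣ m) {B : Finset (Submodule ℂ (Space n))}
    (hB : B ⊆ arrangement (imprimitiveGroup m p n)) :
    ∃ R r c, MonomialRetract m (B.inf id) R r c ∧ n - rk B = R.card ∧ n ≤ R.card + B.card := by
  obtain ⟨R, r, c, h, hcard⟩ := exists_monomialRetract m B fun H hH =>
    exists_coordHyperplane_of_mem_arrangement hpm (hB hH)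
  refine ⟨R, r, c, h, ?_, hcard⟩
  have hR : R.card ≤ n := by simpa using Finset.card_le_univ R
  rw [rk, h.finrank_eq]
  omega

theorem rk_le_card (hpm : p ∣ m) {B : Finset (Submodule ℂ (Space n))}
    (hB : B ⊆ arrangement (imprimitiveGroup m p n)) : rk B ≤ B.card := by
  obtain ⟨R, r, c, -, h1, h2⟩ := exists_retract_of_subset_arrangement hpm hB
  have h3 : rk B ≤ n := Nat.sub_le _ _
  omega

/-- For `p ≠ m` the coordinate hyperplanes already meet in `0`. For `p = m` a second index is
needed: `x i = x j` and `x i = ζ * x j` with `ζ ≠ 1` force both coordinates to vanish. -/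
theorem rk_arrangement (hpm : p ∣ m) (hm : m ≠ 1) (h : m ≠ p ∨ n ≠ 1) :
    rk (arrangement (imprimitiveGroup m p n)) = n := by
  have hbot : (arrangement (imprimitiveGroup m p n)).inf id = ⊥ := by
    refine (Submodule.eq_bot_iff _).mpr fun z hz => ?_
    have hz' : ∀ H ∈ arrangementSet (imprimitiveGroup m p n), z ∈ H := fun H hH =>
      Submodule.mem_finsetInf.mp hz H ((Set.Finite.mem_toFinset _).mpr hH)
    ext i
    rw [PiLp.zero_apply]
    by_cases hmp : m = p
    · have hn : n ≠ 1 := h.resolve_left fun h' => h' hmp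
      have : Nontrivial (Fin n) := Fin.nontrivial_iff_two_le.mpr (by have := i.pos; omega)
      obtain ⟨j, hj⟩ := exists_ne i
      have hprim := Complex.isPrimitiveRoot_exp m (NeZero.ne m)
      obtain ⟨ζ, hζ⟩ : ∃ ζ : ℂˣ, (ζ : ℂ) = Complex.exp (2 * Real.pi * Complex.I / m) :=
        ⟨Units.mk0 _ (Complex.exp_ne_zero _), rfl⟩
      rw [← hζ] at hprim
      have hζ1 : (ζ : ℂ) ≠ 1 := hprim.ne_one (by have := NeZero.ne m; omega)
      have hζm : ζ ^ m = 1 := Units.ext (by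
        rw [Units.val_pow_eq_pow_val, hprim.pow_eq_one, Units.val_one])
      have e1 : z i = ((1 : ℂˣ) : ℂ) * z j := hz' _
        (coordHyperplane_mem_arrangementSet hj.symm (NeZero.ne m) (one_pow m))
      have e2 : z i = (ζ : ℂ) * z j := hz' _
        (coordHyperplane_mem_arrangementSet hj.symm (NeZero.ne m) hζm)
      rw [Units.val_one, one_mul] at e1
      have e3 : ((ζ : ℂ) - 1) * z j = 0 := by rw [sub_mul, ← e2, one_mul, e1, sub_self]
      rw [e1, (mul_eq_zero.mp e3).resolve_left (sub_ne_zero.mpr hζ1)]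
    · have e : z i = 0 * z i := hz' _
        (coordHyperplane_self_mem_arrangementSet i (NeZero.ne m) hpm hmp)
      rw [e, zero_mul]
  rw [rk, hbot, finrank_bot, Nat.sub_zero]

variable {K : Type*} [Field K]

/-- Full rank lets the factor `(y - 1) ^ n` absorb the `- rk B` in the exponent of `y - 1`. -/
theorem pow_mul_tutte (hpm : p ∣ m) (hm : m ≠ 1) (h : m ≠ p ∨ n ≠ 1) (x y : K) :
    (y - 1) ^ n * tutte (imprimitiveGroup m p n) x y =
      ∑ B ∈ (arrangement (imprimitiveGroup m p n)).powerset,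
        ((x - 1) * (y - 1)) ^ (n - rk B) * (y - 1) ^ B.card := by
  rw [tutte, tuttePolynomial, map_sum, Finset.mul_sum]
  refine Finset.sum_congr rfl fun B hB => ?_
  have h1 := rk_le_card hpm (Finset.mem_powerset.mp hB)
  have h2 : rk B ≤ n := Nat.sub_le _ _
  have e : n + (B.card - rk B) = (n - rk B) + B.card := by omega
  simp only [map_mul, map_pow, map_sub, MvPolynomial.aeval_X, map_one, Matrix.cons_val_zero,
    Matrix.cons_val_one, rk_arrangement hpm hm h]
  rw [mul_pow, mul_assoc, ← pow_add, ← e, pow_add]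
  ring

/-- The power of `1 + mk` counts the points of `T^n` on all members of `B`. After exchanging sums,
the sets `B` for a given point are the subsets of the hyperplanes through it, and the binomial
theorem applies. -/
theorem sum_powerset_arrangement (hpm : p ∣ m) (k : ℕ) (v : K) :
    ∑ B ∈ (arrangement (imprimitiveGroup m p n)).powerset,
        (1 + (m : K) * (k : K)) ^ (n - rk B) * v ^ B.card =
      ∑ t : Fin n → Option (Fin k × rootsOfUnity m ℂ),
        (1 + v) ^ (∑ l : Option (Fin k),
          (l.elim m (fun _ => 1) *
            (Finset.univ.filter fun i => (t i).map Prod.fst = l).card.choose 2 +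
          l.elim (if m = p then 0 else (Finset.univ.filter fun i => (t i).map Prod.fst = l).card)
            (fun _ => 0))) := by
  classical
  set A := arrangement (imprimitiveGroup m p n) with hA
  let z : (Fin n → Option (Fin k × rootsOfUnity m ℂ)) → Space n := fun t =>
    WithLp.toLp 2 fun i => orbitPoint m k (t i)
  have h1 : ∀ B ∈ A.powerset, (1 + (m : K) * (k : K)) ^ (n - rk B) * v ^ B.card =
      ∑ t, if z t ∈ B.inf id then v ^ B.card else 0 := by
    intro B hB
    obtain ⟨R, r, c, h, hR, -⟩ :=
      exists_retract_of_subset_arrangement hpm (Finset.mem_powerset.mp hB)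
    have hc := h.card_points (orbitPoint_injective m k) ⟨none, rfl⟩
      fun ζ t hζ => exists_orbitPoint_eq_mul ζ t hζ
    rw [Nat.card_eq_fintype_card, Fintype.card_subtype, Fintype.card_option, Fintype.card_prod,
      Fintype.card_fin, card_rootsOfUnity_complex] at hc
    rw [← Finset.sum_filter, Finset.sum_const, hc, hR, nsmul_eq_mul]
    push_cast
    ring
  rw [Finset.sum_congr rfl h1, Finset.sum_comm]
  refine Finset.sum_congr rfl fun t _ => ?_
  rw [← card_hyperplanes_through_orbitPoint hpm t, ← hA, ← Finset.sum_filter, add_comm 1 v,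
    ← Finset.sum_pow_mul_eq_add_pow]
  refine Finset.sum_congr ?_ fun B _ => by rw [one_pow, mul_one]
  ext B
  simp only [Finset.mem_filter, Finset.mem_powerset, Submodule.mem_finsetInf, id, z]
  constructor
  · rintro ⟨h2, h3⟩ H hH
    exact Finset.mem_filter.mpr ⟨h2 hH, h3 H hH⟩
  · intro h2
    exact ⟨fun H hH => (Finset.mem_filter.mp (h2 hH)).1,
      fun H hH => (Finset.mem_filter.mp (h2 hH)).2⟩

variable [CharZero K]

/-- The exponential generating function of the contributions of the coordinates equal to zero. -/
def zeroSeries (m p : ℕ) (y : K) : PowerSeries K :=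
  PowerSeries.mk fun j => y ^ (m * j.choose 2 + if m = p then 0 else j) /
    ((y - 1) ^ j * (j.factorial : K))

/-- The exponential generating function of the contributions of one free orbit. -/
def orbitSeries (m : ℕ) (y : K) : PowerSeries K :=
  PowerSeries.mk fun j => (m : K) ^ j * y ^ j.choose 2 / ((y - 1) ^ j * (j.factorial : K))

theorem sum_powerset_arrangement_natCast (hpm : p ∣ m) (k : ℕ) {y : K} (hy : y ≠ 1) :
    ∑ B ∈ (arrangement (imprimitiveGroup m p n)).powerset,
        (1 + (m : K) * (k : K)) ^ (n - rk B) * (y - 1) ^ B.card =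
      (y - 1) ^ n * (n.factorial *
        PowerSeries.coeff n (zeroSeries m p y * orbitSeries m y ^ k)) := by
  have hv : y - 1 ≠ 0 := sub_ne_zero.mpr hy
  set a : Option (Fin k) → ℕ → K := fun l j =>
    y ^ (l.elim m (fun _ => 1) * j.choose 2 + l.elim (if m = p then 0 else j) (fun _ => 0)) /
      (y - 1) ^ j with ha
  have hzero : (Finset.univ.filter fun s : Option (Fin k × rootsOfUnity m ℂ) =>
      s.map Prod.fst = none).card = 1 := by
    rw [Finset.card_eq_one]
    exact ⟨none, by ext s; simp⟩
  have horbit : ∀ l : Fin k, (Finset.univ.filter fun s : Option (Fin k × rootsOfUnity m ℂ) =>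
      s.map Prod.fst = some l).card = m := by
    intro l
    refine Eq.trans (Eq.symm ?_)
      (Finset.card_univ.trans (card_rootsOfUnity_complex (m := m)))
    refine Finset.card_bij (fun ζ _ => some (l, ζ)) (by simp) (by simp) ?_
    rintro (_ | ⟨l', ζ⟩) hs
    · simp at hs
    · have hl : l' = l := by simpa using hs
      exact ⟨ζ, Finset.mem_univ _, by rw [hl]⟩
  have hprod : zeroSeries m p y * orbitSeries m y ^ k =
      ∏ l, PowerSeries.mk fun j =>
        ((Finset.univ.filter fun s : Option (Fin k × rootsOfUnity m ℂ) =>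
          s.map Prod.fst = l).card : K) ^ j * a l j / (j.factorial : K) := by
    rw [Fintype.prod_option]
    congr 1
    · ext j
      simp only [zeroSeries, PowerSeries.coeff_mk, hzero, ha, Option.elim_none, Nat.cast_one,
        one_pow, one_mul, div_div]
    · rw [Finset.prod_congr rfl fun l _ => ?_, Finset.prod_const, Finset.card_univ,
        Fintype.card_fin]
      ext j
      simp only [orbitSeries, PowerSeries.coeff_mk, horbit, ha, Option.elim_some, one_mul,
        add_zero, mul_div_assoc, div_div]
  rw [sum_powerset_arrangement hpm k, hprod,
    ← sum_prod_fiber_card (fun s : Option (Fin k × rootsOfUnity m ℂ) => s.map Prod.fst) a n,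
    Finset.mul_sum]
  refine Finset.sum_congr rfl fun t _ => ?_
  -- The class sizes add up to `n`, so the denominators `(y - 1) ^ j` of the classes multiply to `(y
  -- - 1) ^ n`.
  have hn : ∑ l, (Finset.univ.filter fun i => (t i).map Prod.fst = l).card = n := by
    rw [← Finset.card_eq_sum_card_fiberwise fun _ _ => Finset.mem_coe.mpr (Finset.mem_univ _)]
    simp
  rw [add_sub_cancel, ha, Finset.prod_div_distrib, Finset.prod_pow_eq_pow_sum,
    Finset.prod_pow_eq_pow_sum, hn, mul_div_cancel₀ _ (pow_ne_zero n hv)]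

theorem constantCoeff_orbitSeries (m : ℕ) (y : K) :
    PowerSeries.constantCoeff (orbitSeries m y) = 1 := by
  simp [orbitSeries, ← PowerSeries.coeff_zero_eq_constantCoeff_apply]

/-- Both sides are polynomials in `c` that agree at all natural numbers, an infinite set in
characteristic zero. -/
theorem sum_powerset_arrangement_eq (hpm : p ∣ m) (c : K) {y : K} (hy : y ≠ 1) :
    ∑ B ∈ (arrangement (imprimitiveGroup m p n)).powerset,
        (1 + (m : K) * c) ^ (n - rk B) * (y - 1) ^ B.card =
      (y - 1) ^ n * (n.factorial *
        PowerSeries.coeff n (zeroSeries m p y * seriesPow (orbitSeries m y) c)) := by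
  have hF := constantCoeff_orbitSeries m y
  obtain ⟨P, hP⟩ := exists_polynomial_coeff_mul_seriesPow (zeroSeries m p y) hF n
  set Q : Polynomial K := ∑ B ∈ (arrangement (imprimitiveGroup m p n)).powerset,
    (1 + Polynomial.C (m : K) * Polynomial.X) ^ (n - rk B) * Polynomial.C ((y - 1) ^ B.card) with hQ
  have hQe : ∀ c : K, Q.eval c = ∑ B ∈ (arrangement (imprimitiveGroup m p n)).powerset,
      (1 + (m : K) * c) ^ (n - rk B) * (y - 1) ^ B.card := fun c => by
    simp [hQ, Polynomial.eval_finsetSum]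
  have hQP : Q = Polynomial.C ((y - 1) ^ n * n.factorial) * P := by
    refine Polynomial.eq_of_infinite_eval_eq _ _
      ((Set.infinite_range_of_injective (Nat.cast_injective (R := K))).mono ?_)
    rintro _ ⟨k, rfl⟩
    change Q.eval (k : K) = _
    rw [hQe, sum_powerset_arrangement_natCast hpm k hy, Polynomial.eval_mul, Polynomial.eval_C,
      hP, seriesPow_natCast hF, mul_assoc]
  rw [← hQe, hQP, Polynomial.eval_mul, Polynomial.eval_C, hP, mul_assoc]

theorem tutte_div_factorial (hpm : p ∣ m) (hm : m ≠ 1) (h : m ≠ p ∨ n ≠ 1) (x : K) {y : K}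
    (hy : y ≠ 1) :
    tutte (imprimitiveGroup m p n) x y / (n.factorial : K) =
      PowerSeries.coeff n (zeroSeries m p y *
        seriesPow (orbitSeries m y) (((x - 1) * (y - 1) - 1) / (m : K))) := by
  have hm0 : (m : K) ≠ 0 := Nat.cast_ne_zero.mpr (NeZero.ne m)
  have e := sum_powerset_arrangement_eq (n := n) hpm (((x - 1) * (y - 1) - 1) / (m : K)) hy
  rw [mul_div_cancel₀ _ hm0, add_sub_cancel, ← pow_mul_tutte hpm hm h] at e
  rw [mul_left_cancel₀ (pow_ne_zero n (sub_ne_zero.mpr hy)) e,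
    mul_div_cancel_left₀ _ (Nat.cast_ne_zero.mpr (Nat.factorial_ne_zero n))]

/-- The arrangement is empty, so the subset sum is `(x - 1)(y - 1)`; dividing by `y - 1` gives `x -
1`, as if the rank were `1`. -/
theorem coeff_one_self (x : K) {y : K} (hy : y ≠ 1) :
    x - 1 = PowerSeries.coeff 1 (zeroSeries m m y *
        seriesPow (orbitSeries m y) (((x - 1) * (y - 1) - 1) / (m : K))) := by
  have hm0 : (m : K) ≠ 0 := Nat.cast_ne_zero.mpr (NeZero.ne m)
  have hA : arrangement (imprimitiveGroup m m 1) = ∅ := by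
    refine Finset.eq_empty_of_forall_notMem fun H hH => ?_
    rw [arrangement, Set.Finite.mem_toFinset,
      mem_arrangementSet_imprimitiveGroup (NeZero.ne m) dvd_rfl] at hH
    rcases hH with ⟨i, j, ζ, hij, -⟩ | ⟨h, -⟩
    · exact hij.ne (Subsingleton.elim i j)
    · exact h rfl
  have e := sum_powerset_arrangement_eq (n := 1) (p := m) dvd_rfl
    (((x - 1) * (y - 1) - 1) / (m : K)) hy
  rw [mul_div_cancel₀ _ hm0, add_sub_cancel, hA] at e
  refine mul_left_cancel₀ (sub_ne_zero.mpr hy) ?_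
  simpa [rk, mul_comm] using e

end Tutte

end ReflTutte

end

theorem theorem1 (m p : ℕ) [NeZero m] (hpm : p ∣ m) (hmp : m ≠ p)
    {K : Type*} [Field K] [CharZero K] (x y : K) (hy : y ≠ 1) :
    (PowerSeries.mk fun n : ℕ =>
        ReflTutte.tutte (ReflTutte.imprimitiveGroup m p n) x y / (n.factorial : K)) =
      (PowerSeries.mk fun n : ℕ =>
        y ^ (m * n.choose 2 + n) / ((y - 1) ^ n * (n.factorial : K))) *
      ReflTutte.seriesPow
        (PowerSeries.mk fun n : ℕ =>
          (m : K) ^ n * y ^ n.choose 2 / ((y - 1) ^ n * (n.factorial : K)))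
        (((x - 1) * (y - 1) - 1) / (m : K)) ∧
    (PowerSeries.mk fun n : ℕ =>
        (if n = 1 then x - 1 else ReflTutte.tutte (ReflTutte.imprimitiveGroup m m n) x y) /
          (n.factorial : K)) =
      (PowerSeries.mk fun n : ℕ =>
        y ^ (m * n.choose 2) / ((y - 1) ^ n * (n.factorial : K))) *
      ReflTutte.seriesPow
        (PowerSeries.mk fun n : ℕ =>
          (m : K) ^ n * y ^ n.choose 2 / ((y - 1) ^ n * (n.factorial : K)))
        (((x - 1) * (y - 1) - 1) / (m : K)) := by
  -- The second identity involves only `G(m,m,n)`, but it too needs `m ≥ 2` for full rank.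
  have hm : m ≠ 1 := by
    rintro rfl
    exact hmp (Nat.dvd_one.mp hpm).symm
  constructor
  · ext n
    rw [PowerSeries.coeff_mk, ReflTutte.tutte_div_factorial hpm hm (Or.inl hmp) x hy]
    simp only [ReflTutte.zeroSeries, ReflTutte.orbitSeries, if_neg hmp]
  · ext n
    rw [PowerSeries.coeff_mk]
    by_cases hn : n = 1
    · subst hn
      rw [if_pos rfl, Nat.factorial_one, Nat.cast_one, div_one]
      refine (ReflTutte.coeff_one_self (m := m) x hy).trans ?_
      simp only [ReflTutte.zeroSeries, ReflTutte.orbitSeries, if_true, add_zero]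
    · rw [if_neg hn, ReflTutte.tutte_div_factorial dvd_rfl hm (Or.inr hn) x hy]
      simp only [ReflTutte.zeroSeries, ReflTutte.orbitSeries, if_true, add_zero]
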